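/- Let $k\ge 0$ be an integer. For bits $x,y\in\{0,1\}$ let $|\phi_x(y)\rangle\in\mathbb C^2$ be the BB84 encoding $|\phi_0(0)\rangle=|0\rangle$, $|\phi_0(1)\rangle=|1\rangle$, $|\phi_1(0)\rangle=|+\rangle=\frac{1}{\sqrt2}(|0\rangle+|1\rangle)$, $|\phi_1(1)\rangle=|-\rangle=\frac{1}{\sqrt2}(|0\rangle-|1\rangle)$, and for $x,y\in\{0,1\}^k$ put $|\phi_x(y)\rangle=\bigotimes_{i=1}^k|\phi_{x_i}(y_i)\rangle$. Let $\mathbf p$ be any probability distribution on $\{0,1\}^k$ (the distribution of a $k$-bit block $X^k$ of a pseudo-random generator), fix $y\in\{0,1\}^k$ (the publicly known block $Y^k$), and let $$\rho=\sum_{x\in\{0,1\}^k}\mathbf p(x)\,|\phi_x(y)\rangle\langle\phi_x(y)|,\qquad \sigma=\sum_{x\in\{0,1\}^k}2^{-k}\,|\phi_x(y)\rangle\langle\phi_x(y)|$$ be Eve's state $\rho_{Y^k}$ and the fair-input state $\sigma_k$. Let $S(\tau)=-\mathrm{tr}(\tau\ln\tau)$ be the von Neumann entropy and $H(X^k)=-\sum_x\mathbf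 p(x)\ln\mathbf p(x)$ the Shannon entropy, both with natural logarithms, and let $B(\mathbf p)=\frac12\sum_x|\mathbf p(x)-2^{-k}|$ be the bias of $\mathbf p$. If $B(\mathbf p)\le\varepsilon$ and $\varepsilon\le 1/e$, then $$\bigl|(H(X^k)-S(\rho))-(H(X^k)-S(\sigma))\bigr|=|S(\rho)-S(\sigma)|\le 2\ln 2\,(k-1)\,\varepsilon+2\varepsilon\ln\frac1\varepsilon ,$$ where $0\ln\frac10=0$. Thus $H(X^k)-S(\rho)$, the Holevo lower bound on Eve's uncertainty about $X^k$, differs from its fair-input counterpart $H(X^k)-S(\sigma)$ by at most this amount. -/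

import Mathlib

open scoped Matrix

noncomputable section

namespace BB84

/-- Kets of a finite-dimensional Hilbert space with orthonormal (computational) basis `ι`. -/
abbrev Ket (ι : Type*) := ι → ℂ

/-- The vector `|0⟩`. -/
def ketZero : Ket (Fin 2) := ![1, 0]

/-- The vector `|1⟩`. -/
def ketOne : Ket (Fin 2) := ![0, 1]

/-- The vector `|+⟩ = (|0⟩ + |1⟩) / √2`. -/
def ketPlus : Ket (Fin 2) := ((1 / √2 : ℝ) : ℂ) • (ketZero + ketOne)

/-- The vector `|-⟩ = (|0⟩ - |1⟩) / √2`. -/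
def ketMinus : Ket (Fin 2) := ((1 / √2 : ℝ) : ℂ) • (ketZero - ketOne)

/-- The quantum encoder: `qubit x y` encodes the message bit `y` in the computational basis if
the key bit `x` is `0` (`false`), and in the diagonal basis if `x` is `1` (`true`). -/
def qubit : Bool → Bool → Ket (Fin 2)
  | false, false => ketZero
  | false, true => ketOne
  | true, false => ketPlus
  | true, true => ketMinus

/-- The `k`-qubit product ket `⨂ᵢ qubit (x i) (y i)`; the basis of the `k`-qubit space
`(ℂ²)^{⊗ k}` is indexed by `Fin k → Fin 2`. -/
def blockKet {k : ℕ} (x y : Fin k → Bool) : Ket (Fin k → Fin 2) :=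
  fun b => ∏ i, qubit (x i) (y i) (b i)

/-- The operator `|ψ⟩⟨ψ|`. -/
def ketBra {ι : Type*} (ψ : Ket ι) : Matrix ι ι ℂ :=
  Matrix.vecMulVec ψ (star ψ)

/-- The operator `∑ₓ p(x) |φₓ⟩⟨φₓ|`, where `φₓ` is the encoding of the message block `y` with the
key block `x`: the state seen by someone who knows `y`, and knows of the key block only that it
has distribution `p`. -/
def encodedState {k : ℕ} (p : (Fin k → Bool) → ℝ) (y : Fin k → Bool) :
    Matrix (Fin k → Fin 2) (Fin k → Fin 2) ℂ :=
  ∑ x, ((p x : ℝ) : ℂ) • ketBra (blockKet x y)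

theorem ketBra_isHermitian {ι : Type*} (ψ : Ket ι) : (ketBra ψ).IsHermitian := by
  ext i j
  simp [ketBra, Matrix.vecMulVec_apply, mul_comm]

theorem encodedState_isHermitian {k : ℕ} (p : (Fin k → Bool) → ℝ) (y : Fin k → Bool) :
    (encodedState p y).IsHermitian := by
  unfold encodedState Matrix.IsHermitian
  rw [Matrix.conjTranspose_sum]
  refine Finset.sum_congr rfl fun x _ => ?_
  rw [Matrix.conjTranspose_smul, (ketBra_isHermitian (blockKet x y)).eq]
  simp

/-- The uniform distribution on `k`-bit strings. -/
def uniform (k : ℕ) : (Fin k → Bool) → ℝ := fun _ => 1 / 2 ^ k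

/-- The trace distance between two vectors of probabilities. -/
def traceDist {α : Type*} [Fintype α] (a b : α → ℝ) : ℝ := (1 / 2) * ∑ j, |a j - b j|

/-- The bias of a distribution on `k`-bit strings: its trace distance to the uniform one. -/
def bias {k : ℕ} (p : (Fin k → Bool) → ℝ) : ℝ := traceDist p (uniform k)

/-- The Shannon entropy `-∑ p ln p`, in nats (with `0 ln 0 = 0`). -/
def shannonEntropy {α : Type*} [Fintype α] (p : α → ℝ) : ℝ := ∑ j, Real.negMulLog (p j)

/-- The von Neumann entropy `-tr (ρ ln ρ)`, in nats: the Shannon entropy of the spectrum, with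
multiplicities. -/
def vonNeumannEntropy {ι : Type*} [Fintype ι] [DecidableEq ι] {ρ : Matrix ι ι ℂ}
    (hρ : ρ.IsHermitian) : ℝ :=
  shannonEntropy hρ.eigenvalues

/-- The entropy of Eve's state `ρ_y` when the key block has distribution `p`. -/
def stateEntropy {k : ℕ} (p : (Fin k → Bool) → ℝ) (y : Fin k → Bool) : ℝ :=
  vonNeumannEntropy (encodedState_isHermitian p y)

/-- The entropy of the state `σ_k` obtained from a fair (uniformly distributed) key block. -/
def fairStateEntropy {k : ℕ} (y : Fin k → Bool) : ℝ := stateEntropy (uniform k) y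

end BB84

end

/-! This is Fannes' argument. The pointwise maximum `p ⊔ q` of two distributions yields an operator
dominating both encoded states, so by Weyl monotonicity its ordered eigenvalues dominate both
spectra. Comparing traces bounds the total spectral gap by `2 * traceDist p q` and each single gap
by `traceDist p q`. With η = `negMulLog`, a gap d ≤ 1/e changes η by at most η(d); bounding η by its
tangent at the mean gap 2ε/2^k and summing gives the estimate. -/

section Weyl

open Module
open scoped ComplexOrder

variable {𝕜 E : Type*} [RCLike 𝕜] [NormedAddCommGroup E] [InnerProductSpace 𝕜 E]
  [FiniteDimensional 𝕜 E] {n : ℕ} {T S : E →ₗ[𝕜] E}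

/-- The quadratic form of a symmetric operator in its eigenbasis. -/
theorem LinearMap.IsSymmetric.re_inner_apply_self_eq_sum (hT : T.IsSymmetric)
    (hn : finrank 𝕜 E = n) (x : E) :
    RCLike.re (inner 𝕜 x (T x)) =
      ∑ j, hT.eigenvalues hn j * ‖inner 𝕜 (hT.eigenvectorBasis hn j) x‖ ^ 2 := by
  rw [← (hT.eigenvectorBasis hn).sum_inner_mul_inner, map_sum]
  refine Finset.sum_congr rfl fun j _ => ?_
  rw [← hT (hT.eigenvectorBasis hn j) x, hT.apply_eigenvectorBasis, inner_smul_left,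
    RCLike.conj_ofReal, mul_left_comm, RCLike.re_ofReal_mul, inner_mul_symm_re_eq_norm,
    norm_mul, norm_inner_symm x, sq]

/-- **Weyl's monotonicity theorem**: the ordered eigenvalues are monotone in the operator. -/
theorem LinearMap.IsSymmetric.eigenvalues_mono (hT : T.IsSymmetric) (hS : S.IsSymmetric)
    (hn : finrank 𝕜 E = n)
    (h : ∀ x, RCLike.re (inner 𝕜 x (T x)) ≤ RCLike.re (inner 𝕜 x (S x))) (i : Fin n) :
    hT.eigenvalues hn i ≤ hS.eigenvalues hn i := by
  -- Only n - 1 linear conditions, so some nonzero x lies both in the span of the T-eigenvectors of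
  -- index ≤ i and in that of the S-eigenvectors of index ≥ i. Eigenvalues are in decreasing order.
  let f : E →ₗ[𝕜] ({j : Fin n // j ≠ i} → 𝕜) := LinearMap.pi fun j =>
    if i < j.1 then (innerSL 𝕜 (hT.eigenvectorBasis hn j)).toLinearMap
    else (innerSL 𝕜 (hS.eigenvectorBasis hn j)).toLinearMap
  have hf : LinearMap.ker f ≠ ⊥ := by
    apply LinearMap.ker_ne_bot_of_finrank_lt
    rw [finrank_fintype_fun_eq_card, hn, Fintype.card_subtype_compl]
    have := i.2
    simp
    omega
  obtain ⟨x, hx, hx0⟩ := (Submodule.ne_bot_iff _).1 hf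
  have hfx : ∀ j (hj : j ≠ i), f x ⟨j, hj⟩ = 0 := fun j hj => by
    rw [LinearMap.mem_ker.1 hx]; rfl
  have hxT : ∀ j, i < j → inner 𝕜 (hT.eigenvectorBasis hn j) x = 0 := fun j hj => by
    simpa [f, hj] using hfx j hj.ne'
  have hxS : ∀ j, j < i → inner 𝕜 (hS.eigenvectorBasis hn j) x = 0 := fun j hj => by
    simpa [f, hj.not_gt] using hfx j hj.ne
  have hpos : 0 < ‖x‖ ^ 2 := by positivity
  have lower : hT.eigenvalues hn i * ‖x‖ ^ 2 ≤ RCLike.re (inner 𝕜 x (T x)) := by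
    rw [hT.re_inner_apply_self_eq_sum hn, ← (hT.eigenvectorBasis hn).sum_sq_norm_inner_right,
      Finset.mul_sum]
    refine Finset.sum_le_sum fun j _ => ?_
    rcases lt_or_ge i j with hj | hj
    · simp [hxT j hj]
    · exact mul_le_mul_of_nonneg_right (hT.eigenvalues_antitone hn hj) (by positivity)
  have upper : RCLike.re (inner 𝕜 x (S x)) ≤ hS.eigenvalues hn i * ‖x‖ ^ 2 := by
    rw [hS.re_inner_apply_self_eq_sum hn, ← (hS.eigenvectorBasis hn).sum_sq_norm_inner_right,
      Finset.mul_sum]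
    refine Finset.sum_le_sum fun j _ => ?_
    rcases lt_or_ge j i with hj | hj
    · simp [hxS j hj]
    · exact mul_le_mul_of_nonneg_right (hS.eigenvalues_antitone hn hj) (by positivity)
  exact le_of_mul_le_mul_right ((lower.trans (h x)).trans upper) hpos

/-- **Weyl's monotonicity theorem** for Hermitian matrices. -/
theorem Matrix.IsHermitian.eigenvalues_mono {ι : Type*} [Fintype ι] [DecidableEq ι]
    {A B : Matrix ι ι 𝕜} (hA : A.IsHermitian) (hB : B.IsHermitian) (h : (B - A).PosSemidef)
    (i : ι) : hA.eigenvalues i ≤ hB.eigenvalues i := by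
  refine LinearMap.IsSymmetric.eigenvalues_mono _ _ _ (fun x => ?_) _
  have := h.re_dotProduct_nonneg x
  rw [Matrix.sub_mulVec, dotProduct_sub, map_sub, sub_nonneg] at this
  simpa [EuclideanSpace.inner_eq_star_dotProduct, dotProduct_comm] using this

end Weyl

/-! ### Continuity estimates for -x log x -/

section NegMulLog

open Real

/-- Concavity: the right side is the tangent at c. Summed over a spectrum, it does the work of
Jensen's inequality. -/
theorem Real.negMulLog_le_tangent {c x : ℝ} (hc : 0 < c) (hx : 0 ≤ x) :
    negMulLog x ≤ c - x - x * log c := by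
  rcases hx.eq_or_lt with rfl | hx
  · simpa using hc.le
  have h := mul_le_mul_of_nonneg_left (log_le_sub_one_of_pos (div_pos hc hx)) hx.le
  rw [log_div hc.ne' hx.ne', mul_sub, mul_sub, mul_div_cancel₀ _ hx.ne'] at h
  rw [negMulLog]
  linarith

theorem Real.negMulLog_add_le {x y : ℝ} (hx : 0 ≤ x) (hy : 0 ≤ y) :
    negMulLog (x + y) ≤ negMulLog x + negMulLog y := by
  rcases hx.eq_or_lt with rfl | hx
  · simp
  rcases hy.eq_or_lt with rfl | hy
  · simp
  have h₁ := mul_le_mul_of_nonneg_left (log_le_log hx (le_add_of_nonneg_right hy.le)) hx.le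
  have h₂ := mul_le_mul_of_nonneg_left (log_le_log hy (le_add_of_nonneg_left hx.le)) hy.le
  simp only [negMulLog]
  linarith

theorem Real.le_negMulLog {x : ℝ} (hx : 0 ≤ x) (hx' : x ≤ 1 / exp 1) : x ≤ negMulLog x := by
  rcases hx.eq_or_lt with rfl | hx
  · simp
  have h := log_le_log hx hx'
  rw [one_div, log_inv, log_exp] at h
  rw [negMulLog]
  nlinarith

/-- The value x separates the two sides: the tangent at 1 gives the upper bound x on the left, and
log x ≤ -1 the lower bound x on the right. -/
theorem Real.negMulLog_one_sub_le {x : ℝ} (hx : 0 ≤ x) (hx' : x ≤ 1 / exp 1) :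
    negMulLog (1 - x) ≤ negMulLog x := by
  have h1 : 1 / exp 1 ≤ 1 := by
    rw [div_le_one (exp_pos 1)]; exact one_le_exp zero_le_one
  have := negMulLog_le_tangent one_pos (x := 1 - x) (by linarith)
  rw [log_one] at this
  linarith [le_negMulLog hx hx']

/-- The points x + d and 1 - d are mirror images in the segment [x, 1]; adding the concavity
inequalities at both cancels the weights, and η(1) = 0. -/
theorem Real.negMulLog_sub_negMulLog_add_le {x d : ℝ} (hx : 0 ≤ x) (hd : 0 ≤ d)
    (h : x + d ≤ 1) : negMulLog x - negMulLog (x + d) ≤ negMulLog (1 - d) := by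
  rcases (show x ≤ 1 by linarith).eq_or_lt with rfl | hx1
  · obtain rfl : d = 0 := by linarith
    simp
  have h1 : 0 < 1 - x := by linarith
  have ha : 0 ≤ d / (1 - x) := by positivity
  have hb : d / (1 - x) ≤ 1 := by rw [div_le_one h1]; linarith
  have e : d / (1 - x) * (1 - x) = d := div_mul_cancel₀ _ h1.ne'
  set a := d / (1 - x)
  have c₁ := concaveOn_negMulLog.2 hx (Set.mem_Ici.2 zero_le_one) (sub_nonneg.2 hb) ha (by ring)
  have c₂ := concaveOn_negMulLog.2 hx (Set.mem_Ici.2 zero_le_one) ha (sub_nonneg.2 hb) (by ring)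
  simp only [smul_eq_mul, negMulLog_one] at c₁ c₂
  rw [show (1 - a) * x + a * 1 = x + d by linear_combination e] at c₁
  rw [show a * x + (1 - a) * 1 = 1 - d by linear_combination -e] at c₂
  linarith

/-- The modulus of continuity of `-x log x` on the unit interval. -/
theorem Real.abs_negMulLog_sub_le {x y : ℝ} (hx : x ∈ Set.Icc (0 : ℝ) 1)
    (hy : y ∈ Set.Icc (0 : ℝ) 1) (h : |x - y| ≤ 1 / exp 1) :
    |negMulLog x - negMulLog y| ≤ negMulLog |x - y| := by
  wlog hxy : x ≤ y generalizing x y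
  · rw [abs_sub_comm, abs_sub_comm x]
    exact this hy hx (by rwa [abs_sub_comm]) (le_of_not_ge hxy)
  obtain ⟨d, rfl⟩ : ∃ d, y = x + d := ⟨y - x, by ring⟩
  have hd : 0 ≤ d := by linarith
  rw [sub_add_cancel_left, abs_neg, abs_of_nonneg hd] at h ⊢
  refine abs_sub_le_iff.2 ⟨?_, ?_⟩
  · exact (negMulLog_sub_negMulLog_add_le hx.1 hd hy.2).trans (negMulLog_one_sub_le hd h)
  · linarith [negMulLog_add_le hx.1 hd]

end NegMulLog

/-! ### Spectra and entropies of encoded states -/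

namespace BB84

open scoped ComplexOrder
open Real

theorem sum_norm_sq_qubit (x y : Bool) : ∑ b, qubit x y b * star (qubit x y b) = 1 := by
  have h : ((√2 : ℝ) : ℂ) * ((√2 : ℝ) : ℂ) = 2 := by
    rw [← Complex.ofReal_mul, mul_self_sqrt zero_le_two]; norm_num
  cases x <;> cases y <;>
    simp [qubit, ketZero, ketOne, ketPlus, ketMinus, Fin.sum_univ_two, ← mul_inv, h] <;> norm_num

theorem trace_ketBra_blockKet {k : ℕ} (x y : Fin k → Bool) :
    (ketBra (blockKet x y)).trace = 1 := by
  simp only [Matrix.trace, Matrix.diag, ketBra, Matrix.vecMulVec_apply, Pi.star_apply, blockKet,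
    star_prod, ← Finset.prod_mul_distrib]
  rw [← Fintype.prod_sum fun i b => qubit (x i) (y i) b * star (qubit (x i) (y i) b)]
  simp only [sum_norm_sq_qubit, Finset.prod_const_one]

theorem trace_encodedState {k : ℕ} (p : (Fin k → Bool) → ℝ) (y : Fin k → Bool) :
    (encodedState p y).trace = ((∑ x, p x : ℝ) : ℂ) := by
  simp [encodedState, Matrix.trace_sum, Matrix.trace_smul, trace_ketBra_blockKet]

theorem sum_eigenvalues_encodedState {k : ℕ} (p : (Fin k → Bool) → ℝ) (y : Fin k → Bool) :
    ∑ i, (encodedState_isHermitian p y).eigenvalues i = ∑ x, p x := by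
  have h := (encodedState_isHermitian p y).trace_eq_sum_eigenvalues
  rw [trace_encodedState] at h
  exact Complex.ofReal_injective (by simpa using h.symm)

theorem posSemidef_encodedState {k : ℕ} {p : (Fin k → Bool) → ℝ} (hp : 0 ≤ p)
    (y : Fin k → Bool) : (encodedState p y).PosSemidef :=
  Matrix.posSemidef_sum _ fun x _ =>
    (Matrix.posSemidef_vecMulVec_self_star _).smul (Complex.zero_le_real.2 (hp x))

theorem encodedState_sub {k : ℕ} (p q : (Fin k → Bool) → ℝ) (y : Fin k → Bool) :
    encodedState (p - q) y = encodedState p y - encodedState q y := by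
  simp [encodedState, sub_smul, Finset.sum_sub_distrib]

theorem eigenvalues_encodedState_mono {k : ℕ} {p q : (Fin k → Bool) → ℝ} (h : p ≤ q)
    (y : Fin k → Bool) (i : Fin k → Fin 2) :
    (encodedState_isHermitian p y).eigenvalues i ≤ (encodedState_isHermitian q y).eigenvalues i :=
  Matrix.IsHermitian.eigenvalues_mono _ _
    (encodedState_sub q p y ▸ posSemidef_encodedState (sub_nonneg.2 h) y) i

theorem eigenvalues_encodedState_mem_Icc {k : ℕ} {p : (Fin k → Bool) → ℝ}
    (hp : p ∈ stdSimplex ℝ (Fin k → Bool)) (y : Fin k → Bool) (i : Fin k → Fin 2) :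
    (encodedState_isHermitian p y).eigenvalues i ∈ Set.Icc (0 : ℝ) 1 := by
  have h0 := (posSemidef_encodedState (p := p) hp.1 y).eigenvalues_nonneg
  refine ⟨h0 i, ?_⟩
  rw [← hp.2, ← sum_eigenvalues_encodedState p y]
  exact Finset.single_le_sum (fun j _ => h0 j) (Finset.mem_univ i)

theorem traceDist_comm {α : Type*} [Fintype α] (a b : α → ℝ) : traceDist a b = traceDist b a := by
  simp only [traceDist, abs_sub_comm]

theorem sum_sup_sub {α : Type*} [Fintype α] {a b : α → ℝ} (h : ∑ j, a j = ∑ j, b j) :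
    ∑ j, (a ⊔ b) j - ∑ j, b j = traceDist a b := by
  have : ∀ j, (a ⊔ b) j = 1 / 2 * (a j + b j) + 1 / 2 * |a j - b j| := fun j => by
    rw [Pi.sup_apply, sup_eq_half_smul_add_add_abs_sub' ℝ, smul_eq_mul, abs_sub_comm]; ring
  simp only [this, traceDist, Finset.sum_add_distrib, ← Finset.mul_sum, h]
  ring

theorem eigenvalues_encodedState_sub_le {k : ℕ} {p q : (Fin k → Bool) → ℝ}
    (h : ∑ x, p x = ∑ x, q x) (y : Fin k → Bool) (i : Fin k → Fin 2) :
    (encodedState_isHermitian p y).eigenvalues i - (encodedState_isHermitian q y).eigenvalues i ≤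
      traceDist p q := by
  refine (sub_le_sub_right (eigenvalues_encodedState_mono (le_sup_left (b := q)) y i) _).trans ?_
  rw [← sum_sup_sub h, ← sum_eigenvalues_encodedState _ y, ← sum_eigenvalues_encodedState q y,
    ← Finset.sum_sub_distrib]
  -- Every eigenvalue increment from q to `p ⊔ q` is nonnegative, so one increment is at most the
  -- increase in trace.
  exact Finset.single_le_sum
    (f := fun j => (encodedState_isHermitian (p ⊔ q) y).eigenvalues j -
      (encodedState_isHermitian q y).eigenvalues j)
    (fun j _ => sub_nonneg.2 (eigenvalues_encodedState_mono le_sup_right y j)) (Finset.mem_univ i)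

theorem abs_eigenvalues_encodedState_sub_le {k : ℕ} {p q : (Fin k → Bool) → ℝ}
    (h : ∑ x, p x = ∑ x, q x) (y : Fin k → Bool) (i : Fin k → Fin 2) :
    |(encodedState_isHermitian p y).eigenvalues i - (encodedState_isHermitian q y).eigenvalues i| ≤
      traceDist p q :=
  abs_sub_le_iff.2 ⟨eigenvalues_encodedState_sub_le h y i,
    traceDist_comm p q ▸ eigenvalues_encodedState_sub_le h.symm y i⟩

theorem sum_abs_eigenvalues_encodedState_sub_le {k : ℕ} {p q : (Fin k → Bool) → ℝ}
    (h : ∑ x, p x = ∑ x, q x) (y : Fin k → Bool) :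
    ∑ i, |(encodedState_isHermitian p y).eigenvalues i -
      (encodedState_isHermitian q y).eigenvalues i| ≤ 2 * traceDist p q := by
  calc
    _ ≤ ∑ i, (((encodedState_isHermitian (p ⊔ q) y).eigenvalues i -
          (encodedState_isHermitian p y).eigenvalues i) +
        ((encodedState_isHermitian (p ⊔ q) y).eigenvalues i -
          (encodedState_isHermitian q y).eigenvalues i)) := by
      refine Finset.sum_le_sum fun i _ => ?_
      have hp := eigenvalues_encodedState_mono (le_sup_left (a := p) (b := q)) y i
      have hq := eigenvalues_encodedState_mono (le_sup_right (a := p) (b := q)) y i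
      exact abs_sub_le_iff.2 ⟨by linarith, by linarith⟩
    _ = 2 * traceDist p q := by
      simp only [Finset.sum_add_distrib, Finset.sum_sub_distrib, sum_eigenvalues_encodedState]
      have := sum_sup_sub h
      linarith

theorem uniform_mem_stdSimplex (k : ℕ) : uniform k ∈ stdSimplex ℝ (Fin k → Bool) :=
  ⟨fun _ => by unfold uniform; positivity, by simp [uniform]⟩

/-- The **Fannes inequality** for encoded states. -/
theorem abs_stateEntropy_sub_le {k : ℕ} (hk : k ≠ 0) {p q : (Fin k → Bool) → ℝ}
    (hp : p ∈ stdSimplex ℝ (Fin k → Bool)) (hq : q ∈ stdSimplex ℝ (Fin k → Bool))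
    (y : Fin k → Bool) {ε : ℝ} (hε0 : 0 < ε) (hpq : traceDist p q ≤ ε) (hε : ε ≤ 1 / exp 1) :
    |stateEntropy p y - stateEntropy q y| ≤
      2 * log 2 * ((k : ℝ) - 1) * ε + 2 * ε * log (1 / ε) := by
  have hsum : ∑ x, p x = ∑ x, q x := hp.2.trans hq.2.symm
  set l := (encodedState_isHermitian p y).eigenvalues
  set m := (encodedState_isHermitian q y).eigenvalues
  have hT : ∑ i, |l i - m i| ≤ 2 * ε :=
    (sum_abs_eigenvalues_encodedState_sub_le hsum y).trans (by linarith)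
  have hlog : log (2 * ε / 2 ^ k) = -(log 2 * ((k : ℝ) - 1) + log (1 / ε)) := by
    rw [log_div (by positivity) (by positivity), log_mul two_ne_zero hε0.ne', log_pow, one_div,
      log_inv]
    ring
  have hk1 : (0 : ℝ) ≤ k - 1 := by
    have : (1 : ℝ) ≤ k := by exact_mod_cast Nat.one_le_iff_ne_zero.2 hk
    linarith
  have hε1 : 1 ≤ log (1 / ε) := by
    rw [le_log_iff_exp_le (by positivity), le_div_comm₀ (exp_pos 1) hε0]
    exact hε
  have hc : log (2 * ε / 2 ^ k) ≤ -1 := by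
    have := mul_nonneg (log_nonneg one_le_two) hk1
    linarith
  -- The mean gap when a total of 2ε is spread over 2^k eigenvalues.
  set c := 2 * ε / 2 ^ k with hcdef
  have hc0 : 0 < c := by positivity
  calc |stateEntropy p y - stateEntropy q y|
      = |∑ i, (negMulLog (l i) - negMulLog (m i))| := by
        rw [Finset.sum_sub_distrib]; rfl
    _ ≤ ∑ i, |negMulLog (l i) - negMulLog (m i)| := Finset.abs_sum_le_sum_abs _ _
    _ ≤ ∑ i, (c - |l i - m i| - |l i - m i| * log c) := Finset.sum_le_sum fun i _ =>
        (abs_negMulLog_sub_le (eigenvalues_encodedState_mem_Icc hp y i)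
          (eigenvalues_encodedState_mem_Icc hq y i)
          ((abs_eigenvalues_encodedState_sub_le hsum y i).trans (hpq.trans hε))).trans
        (negMulLog_le_tangent hc0 (abs_nonneg _))
    _ = 2 * ε + (∑ i, |l i - m i|) * (-1 - log c) := by
        have : (2 : ℝ) ^ k * c = 2 * ε := by rw [hcdef]; field_simp
        simp only [Finset.sum_sub_distrib, ← Finset.sum_mul, Finset.sum_const, Finset.card_univ,
          Fintype.card_pi, Fintype.card_fin, Finset.prod_const, nsmul_eq_mul, Nat.cast_pow,
          Nat.cast_ofNat, this]
        ring
    -- Enlarging the total gap to 2ε is allowed because log c ≤ -1, which is where k ≥ 1 enters.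
    _ ≤ 2 * ε + 2 * ε * (-1 - log c) := by
        gcongr
    _ = _ := by rw [hlog]; ring

end BB84

theorem mainTheorem1 (k : ℕ) (p : (Fin k → Bool) → ℝ)
    (hp : p ∈ stdSimplex ℝ (Fin k → Bool)) (y : Fin k → Bool) (ε : ℝ)
    (hbias : BB84.bias p ≤ ε) (hε : ε ≤ 1 / Real.exp 1) :
    |(BB84.shannonEntropy p - BB84.stateEntropy p y) -
        (BB84.shannonEntropy p - BB84.fairStateEntropy y)| =
      |BB84.stateEntropy p y - BB84.fairStateEntropy y| ∧
    |BB84.stateEntropy p y - BB84.fairStateEntropy y| ≤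
      2 * Real.log 2 * ((k : ℝ) - 1) * ε + 2 * ε * Real.log (1 / ε) := by
  refine ⟨by rw [sub_sub_sub_cancel_left, abs_sub_comm], ?_⟩
  have hbias0 : 0 ≤ BB84.bias p := by
    unfold BB84.bias BB84.traceDist
    positivity
  rcases (hbias0.trans hbias).eq_or_lt with rfl | hε0
  · have h : p = BB84.uniform k := by
      have h0 : ∑ x, |p x - BB84.uniform k x| = 0 := by
        have := le_antisymm hbias hbias0
        unfold BB84.bias BB84.traceDist at this
        linarith
      funext x
      exact sub_eq_zero.1 (abs_eq_zero.1
        ((Finset.sum_eq_zero_iff_of_nonneg fun _ _ => abs_nonneg _).1 h0 x (Finset.mem_univ x)))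
    simp [h, BB84.fairStateEntropy]
  -- For k = 0 the coefficient k - 1 is negative, but the only distribution is uniform and log (1/ε)
  -- ≥ 1 ≥ log 2 keeps the bound nonnegative.
  rcases eq_or_ne k 0 with rfl | hk
  · have h : p = BB84.uniform 0 := by
      funext x
      rw [← Fintype.sum_subsingleton p x, hp.2]
      simp [BB84.uniform]
    have h1 : 1 ≤ Real.log (1 / ε) := by
      rw [Real.le_log_iff_exp_le (by positivity), le_div_comm₀ (Real.exp_pos 1) hε0]
      exact hε
    have h2 := mul_nonneg hε0.le
      (sub_nonneg.2 ((Real.log_two_lt_d9.le.trans (by norm_num)).trans h1))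
    rw [h, BB84.fairStateEntropy, sub_self, abs_zero]
    push_cast
    linarith
  · exact BB84.abs_stateEntropy_sub_le hk hp (BB84.uniform_mem_stdSimplex k) y hε0 hbias hε
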